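/- A realizer of size $d$ of a finite poset $(X,P)$ is a family $L_1,\dots,L_d$ of linear orders on $X$ whose intersection is $P$, i.e. $x\le y$ in $P$ if and only if $x\le y$ in every $L_j$. A poset is presented on-line via a realizer of size $d$ if its points are introduced one at a time and, in each round, the new point is inserted into each of $d$ linear orders (without changing them on the old points); the poset on the points introduced so far is the intersection of these orders. An on-line chain partitioning algorithm for width $w$ irrevocably assigns a colour to each point as it is introduced, knowing only the $d$ linear orders on the points introduced so far, so that for every presented poset of width at most $w$ each colour class is a chain. Let $\mathrm{olw}_R(w,d)$ be the largest integer $k$ for which there is a strategy for the presenter (Anna), who in each round sees the colours assigned so far and either ends the game or introduces a new point, that forces every such algorithm to use at least $k$ colours on a finite poset of width $w$ presented on-line via a realizer of size $d$ ($\infty$ if there is no largest such $k$). **Theorem.** Let $d\ge 2$ be a fixed integer. Then, as $w\to\infty$, $$\mathrm{olw}_R(w,d)\ \ge\ \Bigl(2-\frac1{d-1}-o(1)\Bigr)\binom{w+1}{2},$$ where the $o(1)$ term is a function of $w$ (and $d$) tending to $0$ as $w\to\infty$. In particular, for every on-line chain partitioning algorithm for width $w$ there is a poset of width $w$, presented on-line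 via a realizer of size $d$, on which the algorithm uses at least $\bigl(2-\frac1{d-1}-o(1)\bigr)\binom{w+1}{2}$ chains, with the same $o(1)$ term. -/

import Mathlib

open Filter Asymptotics

/-- `d` linear orders on the point set `{0, …, n - 1}`; point `i` is the one introduced in
round `i + 1`. Together they are a realizer, of size `d`, of the poset which is their
intersection. -/
@[ext]
structure RealizedPoset (d n : ℕ) where
  /-- `rel j x y` means that `x ≤ y` in the `j`-th linear extension. -/
  rel : Fin d → Fin n → Fin n → Prop
  isLinearOrder : ∀ j, IsLinearOrder (Fin n) (rel j)

namespace RealizedPoset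

variable {d m n : ℕ}

/-- The order of the poset presented via the realizer: the intersection of the `d` linear
extensions. -/
def le (R : RealizedPoset d n) (x y : Fin n) : Prop :=
  ∀ j, R.rel j x y

/-- The position after the first `m` rounds: every linear extension restricted to the first `m`
points. -/
def restrict (R : RealizedPoset d n) (h : m ≤ n) : RealizedPoset d m where
  rel j x y := R.rel j (Fin.castLE h x) (Fin.castLE h y)
  isLinearOrder j :=
    haveI := R.isLinearOrder j
    (Fin.castLE_injective h).isLinearOrder_onFun (r := R.rel j)

open Classical in
/-- The width of the poset: the largest size of an antichain. -/
noncomputable def width (R : RealizedPoset d n) : ℕ :=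
  (Finset.univ.filter fun s : Finset (Fin n) => IsAntichain R.le (s : Set (Fin n))).sup
    Finset.card

/-- The position before the first round. -/
def start (d : ℕ) : RealizedPoset d 0 where
  rel _ _ _ := True
  isLinearOrder _ :=
    { refl := fun _ => trivial
      trans := fun _ _ _ _ _ => trivial
      antisymm := fun x => x.elim0
      total := fun _ _ => Or.inl trivial }

/-- A colouring is a chain partition if any two points of the same colour are comparable. -/
def IsChainPartition (R : RealizedPoset d n) (c : Fin n → ℕ) : Prop :=
  ∀ x y, c x = c y → R.le x y ∨ R.le y x

end RealizedPoset

/-- A (deterministic) on-line algorithm: given the realized poset on the points introduced so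
far, it names the colour of the point that was introduced last. -/
def OnlineAlgorithm (d : ℕ) : Type :=
  ∀ n : ℕ, RealizedPoset d (n + 1) → ℕ

namespace OnlineAlgorithm

variable {d n : ℕ}

/-- The colouring that the algorithm produces on a presented poset: point `i` is coloured on
the basis of the points introduced up to and including `i`. -/
def colouring (A : OnlineAlgorithm d) (R : RealizedPoset d n) (i : Fin n) : ℕ :=
  A i (R.restrict (Nat.succ_le_of_lt i.isLt))

/-- `A` is an on-line chain partitioning algorithm for posets of width at most `w` presented
via a realizer of size `d`. -/
def PartitionsWidth (A : OnlineAlgorithm d) (w : ℕ) : Prop :=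
  ∀ (n : ℕ) (R : RealizedPoset d n), R.width ≤ w → R.IsChainPartition (A.colouring R)

/-- The number of chains (colours) that the algorithm uses on a presented poset. -/
def numChains (A : OnlineAlgorithm d) (R : RealizedPoset d n) : ℕ :=
  (Finset.univ.image (A.colouring R)).card

end OnlineAlgorithm

/-- A strategy for Anna. Knowing the realized poset constructed so far and the colours of its
points, she either ends the game (`none`) or introduces one new point, that is, extends each of
the `d` linear orders by the new point without changing it on the old points. -/
def AnnaStrategy (d : ℕ) : Type :=
  ∀ (n : ℕ) (R : RealizedPoset d n), (Fin n → ℕ) →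
    Option {R' : RealizedPoset d (n + 1) // R'.restrict (Nat.le_succ n) = R}

namespace AnnaStrategy

variable {d : ℕ}

/-- `S.Reaches A n R`: when Anna plays `S` against `A`, then `R` is the position after `n`
rounds. -/
inductive Reaches (S : AnnaStrategy d) (A : OnlineAlgorithm d) :
    ∀ n : ℕ, RealizedPoset d n → Prop
  | start : Reaches S A 0 (RealizedPoset.start d)
  | step (n : ℕ) (R : RealizedPoset d n)
      (R' : {R' : RealizedPoset d (n + 1) // R'.restrict (Nat.le_succ n) = R}) :
      Reaches S A n R → S n R (A.colouring R) = some R' → Reaches S A (n + 1) R'.1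

/-- `S` forces every on-line chain partitioning algorithm to use at least `k` chains on a poset
of width `w`: the game ends with such a poset. -/
def Forces (S : AnnaStrategy d) (w k : ℕ) : Prop :=
  ∀ A : OnlineAlgorithm d, A.PartitionsWidth w →
    ∃ (n : ℕ) (R : RealizedPoset d n),
      S.Reaches A n R ∧ S n R (A.colouring R) = none ∧ R.width = w ∧ k ≤ A.numChains R

end AnnaStrategy

/-- The on-line width of posets of width `w` presented on-line via a realizer of cardinality
`d`: the largest `k` such that Anna has a strategy that forces `k` chains (`⊤` if there is no
largest one). -/
noncomputable def olwR (w d : ℕ) : ℕ∞ :=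
  ⨆ k ∈ {k : ℕ | ∃ S : AnnaStrategy d, S.Forces w k}, (k : ℕ∞)

/-! Presenting a poset via `d` linear orders amounts to placing points in general position in `ℚ ^
d`, ordered coordinatewise. A box whose coordinate intervals contain no coordinate of an old point
(`Slot`) is a region in which every new point has the same relation to each old one. Anna starts
with an antichain of size `w` and plays above it, so the width is exactly `w` whenever she stops.

The engine is `wins_of_chain`. In a slot of width `k`, for any coordinate `i`, she forces a chain
with `k` colours which is last in coordinate `i`, and a box of width `k - 1` incomparable with this
chain remains. The induction keeps a spare chain in another coordinate. A chain with `k - 1` colours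
is forced in the box beside the spare chain, and then a point is put above everything. Either its
colour is new to the forced chain, which is then complete, or it is new to the spare chain, which
cannot happen often because `K` colours there already win.

In `wins_of_slot_succ` this is nested over `d - 1` coordinates in a slot of width `k + 1`, giving
pairwise incomparable chains `D i` with about `k` colours each, hence with disjoint colour sets.
Above all of them the width `k + 1` is available afresh, and the mirrored strategy gives a chain `E`
with `k + 1` colours, first in the remaining coordinate. Each `D i ∪ E` is a chain. As the colours
of `E` are shared out among `d - 1` disjoint sets, averaging gives an `i` for which `D i ∪ E` has
about `(2 - 1 / (d - 1)) * k` colours. A box of width `k` incomparable with this whole chain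
remains, so one unit of width has been spent. `wins_of_slot` iterates this; different levels are
incomparable, so their colours add up. -/

/-! ### Width of sets of points -/

/-- Every antichain in the set `t` of points of `ℚ ^ d` has at most `k` elements. -/
def WidthLE {d : ℕ} (t : Set (Fin d → ℚ)) (k : ℕ) : Prop :=
  ∀ A : Finset (Fin d → ℚ), (A : Set (Fin d → ℚ)) ⊆ t →
    IsAntichain (· ≤ ·) (A : Set (Fin d → ℚ)) → A.card ≤ k

namespace WidthLE

variable {d k l : ℕ} {t u C : Set (Fin d → ℚ)}

theorem subset (h : WidthLE t k) (hu : u ⊆ t) : WidthLE u k :=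
  fun A hA hanti => h A (hA.trans hu) hanti

theorem mono (h : WidthLE t k) (hkl : k ≤ l) : WidthLE t l :=
  fun A hA hanti => (h A hA hanti).trans hkl

theorem empty : WidthLE (∅ : Set (Fin d → ℚ)) k := by
  intro A hA _
  have : A = ∅ := by simpa using Set.subset_eq_empty hA rfl
  simp [this]

theorem singleton (v : Fin d → ℚ) : WidthLE {v} (k + 1) := by
  intro A hA _
  have : A ⊆ {v} := by intro p hp; simpa using hA hp
  exact (Finset.card_le_card this).trans (by simp)

/-- An antichain that meets `u` outside `t` has all its points outside `u` in the chain `C`, so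
there is at most one of them. This is why a box beside a chain costs only one unit of width. -/
theorem union_of_chain (ht : WidthLE t (k + 1)) (hu : WidthLE u k)
    (hC : ∀ p ∈ C, ∀ q ∈ C, p ≤ q ∨ q ≤ p)
    (h : ∀ p ∈ t, p ∉ C → ∀ q ∈ u, p ≤ q ∨ q ≤ p) : WidthLE (t ∪ u) (k + 1) := by
  classical
  intro A hA hanti
  by_cases hAt : (A : Set (Fin d → ℚ)) ⊆ t
  · exact ht A hAt hanti
  obtain ⟨q, hqA, hqt⟩ := Set.not_subset.1 hAt
  have hqu : q ∈ u := (hA hqA).resolve_left hqt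
  have eq_of {p p' : Fin d → ℚ} (hp : p ∈ A) (hp' : p' ∈ A) (hpp : p ≤ p' ∨ p' ≤ p) : p = p' :=
    hpp.elim (fun hle => hanti.eq hp hp' hle) (fun hle => (hanti.eq hp' hp hle).symm)
  rw [← Finset.card_filter_add_card_filter_not (s := A) (fun p => p ∈ u), add_comm k 1, add_comm]
  refine add_le_add ?_ ?_
  · have mem {p : Fin d → ℚ} (hp : p ∈ A.filter fun p => p ∉ u) : p ∈ A ∧ p ∈ C := by
      obtain ⟨hpA, hpu⟩ := Finset.mem_filter.1 hp
      refine ⟨hpA, by_contra fun hpC => hpu ?_⟩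
      rw [eq_of hpA hqA (h p ((hA hpA).resolve_right hpu) hpC q hqu)]
      exact hqu
    exact Finset.card_le_one.2 fun p hp p' hp' =>
      eq_of (mem hp).1 (mem hp').1 (hC p (mem hp).2 p' (mem hp').2)
  · refine hu _ (fun p hp => (Finset.mem_filter.1 hp).2) (hanti.subset fun p hp => ?_)
    exact (Finset.mem_filter.1 hp).1

/-- An antichain lies entirely in one of the two sets, so stacking one on top of the other costs no
width. -/
theorem union_of_comparable (ht : WidthLE t k) (hu : WidthLE u k)
    (h : ∀ p ∈ t, ∀ q ∈ u, p ≤ q ∨ q ≤ p) : WidthLE (t ∪ u) k := by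
  intro A hA hanti
  by_cases hAt : (A : Set (Fin d → ℚ)) ⊆ t
  · exact ht A hAt hanti
  obtain ⟨q, hqA, hqt⟩ := Set.not_subset.1 hAt
  have hqu : q ∈ u := (hA hqA).resolve_left hqt
  refine hu A (fun p hp => (hA hp).elim (fun hpt => ?_) id) hanti
  have : p = q := (h p hpt q hqu).elim (fun hle => hanti.eq hp hqA hle)
    (fun hle => (hanti.eq hqA hp hle).symm)
  exact this ▸ hqu

end WidthLE

/-! ### The game on coloured points -/

/-- A finite set of coloured points of `ℚ ^ d`. -/
abbrev ColouredPoints (d : ℕ) : Type := Finset ((Fin d → ℚ) × ℕ)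

namespace ColouredPoints

variable {d : ℕ}

/-- The underlying points. -/
def points (s : ColouredPoints d) : Set (Fin d → ℚ) := {p | ∃ x, (p, x) ∈ s}

/-- The colours that occur. -/
def colours (s : ColouredPoints d) : Finset ℕ := s.image Prod.snd

/-- Any two points of the same colour are comparable. -/
def Proper (s : ColouredPoints d) : Prop :=
  ∀ p ∈ s, ∀ q ∈ s, p.2 = q.2 → p.1 ≤ q.1 ∨ q.1 ≤ p.1

theorem points_union (s t : ColouredPoints d) : points (s ∪ t) = points s ∪ points t := by
  ext p; simp [points, exists_or]

theorem points_insert (v : Fin d → ℚ) (x : ℕ) (s : ColouredPoints d) :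
    points (insert (v, x) s) = insert v (points s) := by
  ext p; simp [points, exists_or]

@[simp] theorem points_empty : points (∅ : ColouredPoints d) = ∅ := by
  ext p; simp [points]

theorem mem_points {s : ColouredPoints d} {p : (Fin d → ℚ) × ℕ} (hp : p ∈ s) : p.1 ∈ points s :=
  ⟨p.2, hp⟩

theorem points_mono {s t : ColouredPoints d} (h : s ⊆ t) : points s ⊆ points t :=
  fun _ ⟨x, hx⟩ => ⟨x, h hx⟩

@[simp] theorem colours_empty : colours (∅ : ColouredPoints d) = ∅ := rfl

theorem colours_mono {s t : ColouredPoints d} (h : s ⊆ t) : colours s ⊆ colours t :=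
  Finset.image_subset_image h

theorem colours_union (s t : ColouredPoints d) : colours (s ∪ t) = colours s ∪ colours t :=
  Finset.image_union _ _

theorem colours_insert (v : Fin d → ℚ) (x : ℕ) (s : ColouredPoints d) :
    colours (insert (v, x) s) = insert x (colours s) :=
  Finset.image_insert _ _ _

theorem card_colours_insert {x : ℕ} {s : ColouredPoints d} (v : Fin d → ℚ) (hx : x ∉ colours s) :
    (colours (insert (v, x) s)).card = (colours s).card + 1 := by
  rw [colours_insert, Finset.card_insert_of_notMem hx]

/-- The only source of new colours: a shared colour would force two incomparable points to be
comparable. -/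
theorem Proper.disjoint_colours {s t u : ColouredPoints d} (hs : Proper s) (ht : t ⊆ s) (hu : u ⊆ s)
    (h : ∀ p ∈ t, ∀ q ∈ u, ¬(p.1 ≤ q.1) ∧ ¬(q.1 ≤ p.1)) : Disjoint (colours t) (colours u) := by
  rw [Finset.disjoint_left]
  intro x hx hx'
  obtain ⟨p, hp, rfl⟩ := Finset.mem_image.1 hx
  obtain ⟨q, hq, hqp⟩ := Finset.mem_image.1 hx'
  have := h p hp q hq
  rcases hs p (ht hp) q (hu hq) hqp.symm with h1 | h1
  · exact this.1 h1
  · exact this.2 h1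

/-- `Wins w K s`: from the coloured points `s`, Anna can force, by introducing points in general
position one at a time and never exceeding width `w`, either an improper colouring or `K` colours
on a set of width exactly `w`. -/
inductive Wins (w K : ℕ) : ColouredPoints d → Prop
  | done (s : ColouredPoints d) : K ≤ (colours s).card →
      (∃ A : Finset (Fin d → ℚ), (A : Set (Fin d → ℚ)) ⊆ points s ∧
        IsAntichain (· ≤ ·) (A : Set (Fin d → ℚ)) ∧ A.card = w) →
      WidthLE (points s) w → Wins w K s
  | improper (s : ColouredPoints d) : ¬ Proper s → Wins w K s
  | move (s : ColouredPoints d) (v : Fin d → ℚ) : (∀ p ∈ points s, ∀ j, p j ≠ v j) →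
      WidthLE (insert v (points s)) w → (∀ x, Wins w K (insert (v, x) s)) → Wins w K s

/-- An improper colouring is already a win, so Anna may assume properness whenever she has to
compare colours. -/
theorem Wins.of_proper {w K : ℕ} {s : ColouredPoints d} (h : Proper s → Wins w K s) :
    Wins w K s := by
  by_cases hs : Proper s
  · exact h hs
  · exact .improper s hs

end ColouredPoints

open ColouredPoints

/-! ### Boxes in which Anna may play -/

/-- The open box with corners `a` and `b`. -/
def openBox {d : ℕ} (a b : Fin d → ℚ) : Set (Fin d → ℚ) := {p | ∀ j, a j < p j ∧ p j < b j}

/-- All points of the open box between `a` and `b` have the same position with respect to the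
points of `s`, and a set of width at most `k` may be added in the box without exceeding width
`w`. -/
structure Slot {d : ℕ} (w : ℕ) (s : ColouredPoints d) (a b : Fin d → ℚ) (k : ℕ) : Prop where
  lt : ∀ j, a j < b j
  outside : ∀ p ∈ points s, ∀ j, p j ≤ a j ∨ b j ≤ p j
  full : ∃ A : Finset (Fin d → ℚ), (A : Set (Fin d → ℚ)) ⊆ points s ∧
    IsAntichain (· ≤ ·) (A : Set (Fin d → ℚ)) ∧ A.card = w
  width : ∀ u ⊆ openBox a b, WidthLE u k → WidthLE (points s ∪ u) w

/-- A slot carries an antichain of size `w` and the width bound, so Anna may stop as soon as the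
colours suffice. -/
theorem Slot.wins {d w k K : ℕ} {s : ColouredPoints d} {a b : Fin d → ℚ} (h : Slot w s a b k)
    (hK : K ≤ (colours s).card) : Wins w K s :=
  .done s hK h.full (by simpa using h.width ∅ (Set.empty_subset _) .empty)

/-- Points `t` in the open box between `a` and `b`, all of them below `m`, with chains `D i`. The
chain `D i` consists of the last points of `t` in the `i`-th coordinate, and `c i`, `c' i` separate
it from the other points. The box between `c` and `c'` can be used for a set of width at most `k'`
without exceeding width `k` in the box between `a` and `b`. -/
structure ChainStack {d : ℕ} (a b : Fin d → ℚ) (t : ColouredPoints d)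
    (D : Fin d → ColouredPoints d) (c c' m : Fin d → ℚ) (k k' : ℕ) : Prop where
  sub : ∀ i, D i ⊆ t
  chain : ∀ i, ∀ p ∈ D i, ∀ q ∈ D i, p.1 ≤ q.1 ∨ q.1 ≤ p.1
  disjoint : ∀ i j, i ≠ j → ∀ p ∈ D i, p ∉ D j
  lt_of_mem : ∀ p ∈ t, ∀ j, a j < p.1 j
  le_of_mem : ∀ p ∈ t, ∀ j, p.1 j ≤ m j
  a_le_c : ∀ j, a j ≤ c j
  c_le_m : ∀ j, c j ≤ m j
  c_lt_c' : ∀ j, c j < c' j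
  c'_le_b : ∀ j, c' j ≤ b j
  m_lt_b : ∀ j, m j < b j
  le_c : ∀ i, ∀ p ∈ t, p ∉ D i → p.1 i ≤ c i
  c'_le : ∀ i, ∀ p ∈ D i, c' i ≤ p.1 i
  width : ∀ u ⊆ openBox c c', WidthLE u k' → WidthLE (points t ∪ u) k

namespace ChainStack

variable {d w k k' k'' : ℕ} {s t t₂ : ColouredPoints d} {D D₂ : Fin d → ColouredPoints d}
  {a b c c' m c₂ c₂' m₂ : Fin d → ℚ}

theorem mem_openBox (h : ChainStack a b t D c c' m k k') {p : Fin d → ℚ} (hp : p ∈ points t) :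
    p ∈ openBox a b := by
  obtain ⟨x, hx⟩ := hp
  exact fun j => ⟨h.lt_of_mem _ hx j, (h.le_of_mem _ hx j).trans_lt (h.m_lt_b j)⟩

theorem openBox_subset (h : ChainStack a b t D c c' m k k') : openBox c c' ⊆ openBox a b :=
  fun _ hp j => ⟨(h.a_le_c j).trans_lt (hp j).1, (hp j).2.trans_le (h.c'_le_b j)⟩

theorem widthLE (h : ChainStack a b t D c c' m k k') : WidthLE (points t) k := by
  simpa using h.width ∅ (Set.empty_subset _) .empty

/-- In coordinate `j` the points of `D j` are beyond `c' j` and all others are before `c j`, so the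
inner box is again a slot. The width bounds compose because the outer slot sees `t ∪ u` as a single
set. -/
theorem slot (h : ChainStack a b t D c c' m k k') (hs : Slot w s a b k) :
    Slot w (s ∪ t) c c' k' where
  lt := h.c_lt_c'
  outside p hp j := by
    rw [points_union] at hp
    rcases hp with hp | ⟨x, hp⟩
    · exact (hs.outside p hp j).imp (fun h1 => h1.trans (h.a_le_c j))
        (fun h1 => (h.c'_le_b j).trans h1)
    · by_cases hD : (p, x) ∈ D j
      · exact Or.inr (h.c'_le j _ hD)
      · exact Or.inl (h.le_c j _ hp hD)
  full := by
    obtain ⟨A, hA, h1⟩ := hs.full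
    exact ⟨A, hA.trans (points_mono Finset.subset_union_left), h1⟩
  width u hu hk := by
    rw [points_union, Set.union_assoc]
    refine hs.width _ ?_ (h.width u hu hk)
    exact Set.union_subset (fun p hp => h.mem_openBox hp) (hu.trans h.openBox_subset)

theorem empty (hab : ∀ j, a j < b j) (hk : k' ≤ k) :
    ChainStack a b ∅ (fun _ => ∅) a b a k k' where
  sub := by simp
  chain := by simp
  disjoint := by simp
  lt_of_mem := by simp
  le_of_mem := by simp
  a_le_c _ := le_rfl
  c_le_m _ := le_rfl
  c_lt_c' := hab
  c'_le_b _ := le_rfl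
  m_lt_b := hab
  le_c := by simp
  c'_le := by simp
  width u _ hk' := by simpa using hk'.mono hk

/-- Points of different chains are incomparable. -/
theorem incomparable (h : ChainStack a b t D c c' m k k') {i j : Fin d} (hij : i ≠ j) :
    ∀ p ∈ D i, ∀ q ∈ D j, ¬(p.1 ≤ q.1) ∧ ¬(q.1 ≤ p.1) := by
  intro p hp q hq
  have h1 := h.c'_le i p hp
  have h2 := h.c'_le j q hq
  have h3 := h.le_c j p (h.sub i hp) (h.disjoint i j hij p hp)
  have h4 := h.le_c i q (h.sub j hq) (h.disjoint j i hij.symm q hq)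
  have h5 := h.c_lt_c' i
  have h6 := h.c_lt_c' j
  exact ⟨fun hle => by linarith [hle i], fun hle => by linarith [hle j]⟩

/-- Nested play. The points of `D i` are beyond the inner box in coordinate `i`, so they need not be
comparable with the points of `D₂ i`; hence `hD` lets each coordinate receive its chain from only
one of the two stacks. -/
theorem union (h : ChainStack a b t D c c' m k k') (h₂ : ChainStack c c' t₂ D₂ c₂ c₂' m₂ k' k'')
    (hD : ∀ i, D i = ∅ ∨ D₂ i = ∅) :
    ChainStack a b (t ∪ t₂) (fun i => D i ∪ D₂ i) c₂ c₂' (m ⊔ m₂) k k'' := by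
  have hne (i : Fin d) {p} (hp : p ∈ D i) (hp₂ : p ∈ t₂) : False := by
    have h1 := h.c'_le i p hp
    have h3 := h₂.le_of_mem p hp₂ i
    have h4 := h₂.m_lt_b i
    linarith
  exact {
    sub := fun i => Finset.union_subset_union (h.sub i) (h₂.sub i)
    chain := fun i => by
      rcases hD i with h1 | h1
      · simpa [h1] using h₂.chain i
      · simpa [h1] using h.chain i
    disjoint := fun i j hij p hp hq => by
      rcases Finset.mem_union.1 hp with hp | hp <;> rcases Finset.mem_union.1 hq with hq | hq
      · exact h.disjoint i j hij p hp hq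
      · exact hne i hp (h₂.sub j hq)
      · exact hne j hq (h₂.sub i hp)
      · exact h₂.disjoint i j hij p hp hq
    lt_of_mem := fun p hp j => by
      rcases Finset.mem_union.1 hp with hp | hp
      · exact h.lt_of_mem p hp j
      · exact (h.a_le_c j).trans_lt (h₂.lt_of_mem p hp j)
    le_of_mem := fun p hp j => by
      rcases Finset.mem_union.1 hp with hp | hp
      · exact le_sup_of_le_left (h.le_of_mem p hp j)
      · exact le_sup_of_le_right (h₂.le_of_mem p hp j)
    a_le_c := fun j => (h.a_le_c j).trans (h₂.a_le_c j)
    c_le_m := fun j => le_sup_of_le_right (h₂.c_le_m j)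
    c_lt_c' := h₂.c_lt_c'
    c'_le_b := fun j => (h₂.c'_le_b j).trans (h.c'_le_b j)
    m_lt_b := fun j => max_lt (h.m_lt_b j) ((h₂.m_lt_b j).trans_le (h.c'_le_b j))
    le_c := fun i p hp hpD => by
      rw [Finset.mem_union, not_or] at hpD
      rcases Finset.mem_union.1 hp with hp | hp
      · exact (h.le_c i p hp hpD.1).trans (h₂.a_le_c i)
      · exact h₂.le_c i p hp hpD.2
    c'_le := fun i p hp => by
      rcases Finset.mem_union.1 hp with hp | hp
      · exact (h₂.c'_le_b i).trans (h.c'_le i p hp)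
      · exact h₂.c'_le i p hp
    width := fun u hu hk => by
      rw [points_union, Set.union_assoc]
      refine h.width _ ?_ (h₂.width u hu hk)
      exact Set.union_subset (fun p hp => h₂.mem_openBox hp) (hu.trans h₂.openBox_subset) }

theorem widthLE_insert (h : ChainStack a b t D c c' m (k + 1) k') {y : Fin d → ℚ}
    (hy : ∀ j, m j < y j) : WidthLE (insert y (points t)) (k + 1) := by
  rw [Set.insert_eq, Set.union_comm]
  refine h.widthLE.union_of_comparable (.singleton y) ?_
  rintro p ⟨x, hp⟩ q rfl
  exact Or.inl fun j => (h.le_of_mem _ hp j).trans (hy j).le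

/-- Add a point above all others to one of the chains and forget the other chains. -/
theorem push (h : ChainStack a b t D c c' m (k + 1) k') {y : Fin d → ℚ}
    (hy : ∀ j, m j < y j) (hyb : ∀ j, y j < b j) (x : ℕ) (i : Fin d) :
    ChainStack a b (insert (y, x) t) (fun j => if j = i then insert (y, x) (D i) else ∅)
      (Function.update y i (c i)) (Function.update b i (min (c' i) (y i))) y (k + 1) k := by
  have hley : ∀ p ∈ t, p.1 ≤ y := fun p hp j => (h.le_of_mem p hp j).trans (hy j).le
  have hchain : ∀ p ∈ insert (y, x) (D i), ∀ q ∈ insert (y, x) (D i), p.1 ≤ q.1 ∨ q.1 ≤ p.1 := by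
    intro p hp q hq
    rcases Finset.mem_insert.1 hp with rfl | hp <;> rcases Finset.mem_insert.1 hq with rfl | hq
    · exact Or.inl le_rfl
    · exact Or.inr (hley q (h.sub i hq))
    · exact Or.inl (hley p (h.sub i hp))
    · exact h.chain i p hp q hq
  refine {
    sub := fun j => ?_
    chain := fun j => ?_
    disjoint := fun j l hjl p hp hp' => ?_
    lt_of_mem := fun p hp j => ?_
    le_of_mem := fun p hp j => ?_
    a_le_c := fun j => ?_
    c_le_m := fun j => ?_
    c_lt_c' := fun j => ?_
    c'_le_b := fun j => ?_
    m_lt_b := hyb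
    le_c := fun j p hp hpD => ?_
    c'_le := fun j p hp => ?_
    width := fun u hu hk => ?_ }
  · split_ifs
    · exact Finset.insert_subset_insert _ (h.sub i)
    · simp
  · split_ifs
    · exact hchain
    · simp
  · split_ifs at hp hp' with h1 h2
    · exact hjl (h1.trans h2.symm)
    all_goals simp_all
  · rcases Finset.mem_insert.1 hp with rfl | hp
    · exact ((h.a_le_c j).trans (h.c_le_m j)).trans_lt (hy j)
    · exact h.lt_of_mem p hp j
  · rcases Finset.mem_insert.1 hp with rfl | hp
    · exact le_rfl
    · exact hley p hp j
  · rcases eq_or_ne j i with rfl | hj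
    · simpa using h.a_le_c j
    · simpa [hj] using ((h.a_le_c j).trans (h.c_le_m j)).trans (hy j).le
  · rcases eq_or_ne j i with rfl | hj
    · simpa using (h.c_le_m j).trans (hy j).le
    · simp [hj]
  · rcases eq_or_ne j i with rfl | hj
    · simpa using ⟨h.c_lt_c' j, (h.c_le_m j).trans_lt (hy j)⟩
    · simpa [hj] using hyb j
  · rcases eq_or_ne j i with rfl | hj
    · simpa using Or.inl (h.c'_le_b j)
    · simp [hj]
  · rcases eq_or_ne j i with rfl | hj
    · simp only [if_true, Finset.mem_insert, not_or] at hpD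
      simpa using h.le_c j p ((Finset.mem_insert.1 hp).resolve_left hpD.1) hpD.2
    · rcases Finset.mem_insert.1 hp with rfl | hp
      · simp [hj]
      · simpa [hj] using hley p hp j
  · rcases eq_or_ne j i with rfl | hj
    · simp only [if_true, Finset.mem_insert] at hp
      rcases hp with rfl | hp
      · simp
      · simpa using Or.inl (h.c'_le j p hp)
    · simp [hj] at hp
  -- Old points outside the extended chain are at most `c i` in coordinate `i` and below `y`
  -- elsewhere, hence below the new box. Only the chain costs width.
  · rw [points_insert]
    refine (h.widthLE_insert hy).union_of_chain hk (C := points (insert (y, x) (D i))) ?_ ?_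
    · rintro p ⟨z, hp⟩ q ⟨z', hq⟩
      exact hchain _ hp _ hq
    · intro p hp hpC q hq
      rw [points_insert, Set.mem_insert_iff, not_or] at hpC
      obtain ⟨z, hp⟩ := hp.resolve_left hpC.1
      refine Or.inl fun j => ?_
      have hqj := (hu hq j).1
      rcases eq_or_ne j i with rfl | hj
      · have := h.le_c j _ hp fun hpD => hpC.2 ⟨z, hpD⟩
        simp only [Function.update_self] at hqj
        exact this.trans hqj.le
      · simp only [Function.update_of_ne hj] at hqj
        exact (hley _ hp j).trans hqj.le

end ChainStack

/-! ### Forcing a chain with many colours -/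

section Chains

variable {d w K : ℕ}

/-- Any `y` strictly between `m` and `b` in every coordinate is in general position, and lying above
all of `t` it does not increase the width of `t`. -/
theorem Slot.move_above {k k' : ℕ} {s t : ColouredPoints d} {D : Fin d → ColouredPoints d}
    {a b c c' m : Fin d → ℚ} (hs : Slot w s a b (k + 1))
    (h : ChainStack a b t D c c' m (k + 1) k')
    (H : ∀ y : Fin d → ℚ, (∀ j, m j < y j) → (∀ j, y j < b j) → ∀ x,
      Wins w K (s ∪ insert (y, x) t)) : Wins w K (s ∪ t) := by
  choose y hy hyb using fun j => exists_between (h.m_lt_b j)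
  have hay (j) : a j < y j := ((h.a_le_c j).trans (h.c_le_m j)).trans_lt (hy j)
  refine .move _ y ?_ ?_ fun x => ?_
  · intro p hp j
    rw [points_union] at hp
    rcases hp with hp | ⟨x, hp⟩
    · rcases hs.outside p hp j with h1 | h1
      · exact (h1.trans_lt (hay j)).ne
      · exact ((hyb j).trans_le h1).ne'
    · exact ((h.le_of_mem _ hp j).trans_lt (hy j)).ne
  · rw [points_union, ← Set.union_insert]
    refine hs.width _ ?_ (h.widthLE_insert hy)
    exact Set.insert_subset (fun j => ⟨hay j, hyb j⟩) fun p hp => h.mem_openBox hp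
  · rw [← Finset.union_insert]
    exact H y hy hyb x

/-- In a slot of width `k`, Anna can force a chain with `k` colours that is last in any given
coordinate, unless the algorithm uses `K` colours. -/
theorem wins_of_chain (hd : 2 ≤ d) (k : ℕ) : ∀ (i : Fin d) (s : ColouredPoints d)
    (a b : Fin d → ℚ), Slot w s a b k →
    (∀ t D c c' m, ChainStack a b t D c c' m k (k - 1) → (∀ j, j ≠ i → D j = ∅) →
      k ≤ (colours (D i)).card → Wins w K (s ∪ t)) → Wins w K s := by
  have : Nontrivial (Fin d) := Fin.nontrivial_iff_two_le.2 hd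
  induction k with
  | zero =>
    intro i s a b hs H
    simpa using H ∅ (fun _ => ∅) a b a (.empty hs.lt le_rfl) (fun _ _ => rfl) (Nat.zero_le _)
  | succ k ih =>
    intro i s a b hs H
    obtain ⟨i', hi'⟩ := exists_ne i
    -- `N` bounds how many colours the spare chain in coordinate `i'` still lacks. Once it has `K`
    -- of them, Anna stops.
    have loop (N : ℕ) : ∀ t D c c' m, ChainStack a b t D c c' m (k + 1) k →
        (∀ j, j ≠ i' → D j = ∅) → K ≤ (colours (D i')).card + N → Wins w K (s ∪ t) := by
      induction N with
      | zero =>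
        intro t D c c' m h _ hK
        refine (h.slot hs).wins (hK.trans (Finset.card_le_card (colours_mono ?_)))
        exact (h.sub i').trans Finset.subset_union_right
      | succ N ihN =>
        intro t D c c' m h hD hK
        refine ih i _ c c' (h.slot hs) fun t₂ D₂ c₂ c₂' m₂ h₂ hD₂ hk => ?_
        have hu := h.union h₂ fun j => by
          rcases eq_or_ne j i' with rfl | hj
          · exact Or.inr (hD₂ _ hi')
          · exact Or.inl (hD j hj)
        rw [Finset.union_assoc]
        refine hs.move_above hu fun y hy hyb x => .of_proper fun hproper => ?_
        have hpush := fun i => hu.push hy hyb x i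
        -- The point `y` is above everything, so it may extend either chain. A colour of `D₂ i`
        -- cannot occur in the incomparable chain `D i'`, which therefore gains a colour; any other
        -- colour completes `D₂ i` to `k + 1` colours.
        by_cases hx : x ∈ colours (D₂ i)
        · refine ihN _ _ _ _ _ (hpush i') (fun j hj => if_neg hj) ?_
          rw [if_pos rfl, hD₂ i' hi', Finset.union_empty, card_colours_insert]
          · omega
          intro hx'
          have hsub (j) : D j ∪ D₂ j ⊆ s ∪ insert (y, x) (t ∪ t₂) :=
            ((hu.sub j).trans (Finset.subset_insert _ _)).trans Finset.subset_union_right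
          have := hproper.disjoint_colours (hsub i) (hsub i') (hu.incomparable hi'.symm)
          rw [colours_union, colours_union, Finset.disjoint_left] at this
          exact this (Finset.mem_union_right _ hx) (Finset.mem_union_left _ hx')
        · refine H _ _ _ _ _ (hpush i) (fun j hj => if_neg hj) ?_
          rw [if_pos rfl, hD i hi'.symm, Finset.empty_union, card_colours_insert _ hx]
          omega
    simpa using loop K ∅ (fun _ => ∅) a b a (.empty hs.lt k.le_succ) (fun _ _ => rfl)
      (Nat.le_add_left _ _)

/-- Anna can force chains with many colours that are last in different coordinates. -/
theorem wins_of_chains (hd : 2 ≤ d) {k : ℕ} {s : ColouredPoints d} {a b : Fin d → ℚ}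
    (hs : Slot w s a b k) (I : Finset (Fin d)) :
    (∀ t D c c' m, ChainStack a b t D c c' m k (k - I.card) → (∀ j, j ∉ I → D j = ∅) →
      (∀ j ∈ I, k - I.card ≤ (colours (D j)).card) → Wins w K (s ∪ t)) → Wins w K s := by
  induction I using Finset.induction_on with
  | empty =>
    intro H
    simpa using H ∅ (fun _ => ∅) a b a (.empty hs.lt (Nat.sub_le _ _)) (fun _ _ => rfl) (by simp)
  | insert i I hi ih =>
    intro H
    refine ih fun t D c c' m h hD hk => ?_
    -- The next chain is forced inside the box beside the earlier ones, and one unit of width is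
    -- lost for each chain.
    refine wins_of_chain hd _ i _ c c' (h.slot hs) fun t₂ D₂ c₂ c₂' m₂ h₂ hD₂ hk₂ => ?_
    have hu := h.union h₂ fun j => by
      rcases eq_or_ne j i with rfl | hj
      · exact Or.inl (hD _ hi)
      · exact Or.inr (hD₂ j hj)
    rw [Finset.union_assoc]
    rw [Finset.card_insert_of_notMem hi] at H
    refine H _ _ _ _ _ hu (fun j hj => ?_) fun j hj => ?_
    · rw [Finset.mem_insert, not_or] at hj
      rw [hD j hj.2, hD₂ j hj.1, Finset.empty_union]
    · rw [colours_union]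
      rcases Finset.mem_insert.1 hj with rfl | hj
      · exact ((by omega : _ ≤ _).trans hk₂).trans (Finset.card_le_card Finset.subset_union_right)
      · exact ((by omega : _ ≤ _).trans (hk j hj)).trans
          (Finset.card_le_card Finset.subset_union_left)

end Chains

/-! ### Reversing the order -/

namespace ColouredPoints

variable {d w K : ℕ}

/-- The reversed order. -/
def reflect (s : ColouredPoints d) : ColouredPoints d := s.image fun p => (-p.1, p.2)

theorem mem_reflect {s : ColouredPoints d} {p : (Fin d → ℚ) × ℕ} :
    p ∈ reflect s ↔ (-p.1, p.2) ∈ s := by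
  obtain ⟨p, x⟩ := p
  simp only [reflect, Finset.mem_image, Prod.mk.injEq, Prod.exists]
  constructor
  · rintro ⟨q, y, h, rfl, rfl⟩
    simpa using h
  · intro h
    exact ⟨-p, x, h, neg_neg p, rfl⟩

@[simp] theorem reflect_reflect (s : ColouredPoints d) : reflect (reflect s) = s := by
  ext p; simp [mem_reflect]

theorem reflect_union (s t : ColouredPoints d) : reflect (s ∪ t) = reflect s ∪ reflect t :=
  Finset.image_union _ _

theorem points_reflect (s : ColouredPoints d) : points (reflect s) = Neg.neg ⁻¹' points s := by
  ext p; simp [points, mem_reflect]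

@[simp] theorem colours_reflect (s : ColouredPoints d) : colours (reflect s) = colours s := by
  simp only [colours, reflect, Finset.image_image]
  rfl

theorem _root_.IsAntichain.image_neg_finset {A : Finset (Fin d → ℚ)}
    (hA : IsAntichain (· ≤ ·) (A : Set (Fin d → ℚ))) :
    IsAntichain (· ≤ ·) ((A.image Neg.neg : Finset (Fin d → ℚ)) : Set (Fin d → ℚ)) := by
  intro p hp q hq hne hle
  simp only [Finset.coe_image, Set.mem_image] at hp hq
  obtain ⟨p, hp, rfl⟩ := hp
  obtain ⟨q, hq, rfl⟩ := hq
  exact hA hq hp (fun h => hne (by rw [h])) (neg_le_neg_iff.1 hle)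

theorem _root_.WidthLE.preimage_neg {t : Set (Fin d → ℚ)} {k : ℕ} (h : WidthLE t k) :
    WidthLE (Neg.neg ⁻¹' t) k := by
  intro A hA hanti
  rw [← Finset.card_image_of_injective A neg_injective]
  refine h _ (fun p hp => ?_) hanti.image_neg_finset
  simp only [Finset.coe_image, Set.mem_image] at hp
  obtain ⟨p, hp, rfl⟩ := hp
  exact hA hp

theorem exists_antichain_reflect {s : ColouredPoints d}
    (h : ∃ A : Finset (Fin d → ℚ), (A : Set (Fin d → ℚ)) ⊆ points s ∧
      IsAntichain (· ≤ ·) (A : Set (Fin d → ℚ)) ∧ A.card = w) :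
    ∃ A : Finset (Fin d → ℚ), (A : Set (Fin d → ℚ)) ⊆ points (reflect s) ∧
      IsAntichain (· ≤ ·) (A : Set (Fin d → ℚ)) ∧ A.card = w := by
  obtain ⟨A, hA, hanti, hcard⟩ := h
  refine ⟨A.image Neg.neg, fun p hp => ?_, hanti.image_neg_finset, ?_⟩
  · simp only [Finset.coe_image, Set.mem_image] at hp
    obtain ⟨p, hp, rfl⟩ := hp
    rw [points_reflect, Set.mem_preimage, neg_neg]
    exact hA hp
  · rw [Finset.card_image_of_injective A neg_injective, hcard]

/-- Negation preserves comparability, antichains and general position, so strategies can be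
mirrored; this turns final chains into initial ones. -/
theorem Wins.reflect {s : ColouredPoints d} (h : Wins w K s) : Wins w K (reflect s) := by
  induction h with
  | done s hK hA hw =>
    refine .done _ (by simpa using hK) (exists_antichain_reflect hA) ?_
    rw [points_reflect]
    exact hw.preimage_neg
  | improper s hs =>
    refine .improper _ fun h => hs fun p hp q hq hpq => ?_
    have := h (-p.1, p.2) (by simpa [mem_reflect] using hp) (-q.1, q.2)
      (by simpa [mem_reflect] using hq) hpq
    exact this.symm.imp neg_le_neg_iff.1 neg_le_neg_iff.1
  | move s v hv hw _ ih =>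
    refine .move _ (-v) (fun p hp j hpj => ?_) ?_ fun x => ?_
    · rw [points_reflect] at hp
      exact hv (-p) hp j (by simp [hpj])
    · have := hw.preimage_neg
      refine this.subset ?_
      rw [points_reflect, Set.insert_subset_iff]
      exact ⟨by simp, Set.preimage_mono (Set.subset_insert _ _)⟩
    · have := ih x
      rwa [ColouredPoints.reflect, Finset.image_insert] at this

end ColouredPoints

theorem Slot.reflect {d w k : ℕ} {s : ColouredPoints d} {a b : Fin d → ℚ} (h : Slot w s a b k) :
    Slot w (reflect s) (-b) (-a) k where
  lt j := neg_lt_neg (h.lt j)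
  outside p hp j := by
    rw [points_reflect] at hp
    refine (h.outside _ hp j).symm.imp (fun h1 => ?_) (fun h1 => ?_)
    · exact le_neg.1 h1
    · exact neg_le.1 h1
  full := exists_antichain_reflect h.full
  width u hu hk := by
    refine (h.width _ (fun p hp => ?_) hk.preimage_neg).preimage_neg.subset ?_
    · intro j
      have h1 := hu hp j
      exact ⟨neg_lt_neg_iff.1 h1.2, neg_lt_neg_iff.1 h1.1⟩
    · rw [points_reflect]
      rintro p (hp | hp)
      · exact Or.inl hp
      · exact Or.inr (by simpa using hp)

/-- Points `t` in the open box between `a` and `b`, all of them above `m`, and a chain `E` of the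
first points of `t` in the `i`-th coordinate; `e` and `e'` separate it from the other points. -/
structure InitialChain {d : ℕ} (a b : Fin d → ℚ) (t E : ColouredPoints d) (i : Fin d)
    (m : Fin d → ℚ) (e e' : ℚ) (k : ℕ) : Prop where
  sub : E ⊆ t
  chain : ∀ p ∈ E, ∀ q ∈ E, p.1 ≤ q.1 ∨ q.1 ≤ p.1
  lt_of_mem : ∀ p ∈ t, ∀ j, p.1 j < b j
  le_of_mem : ∀ p ∈ t, ∀ j, m j ≤ p.1 j
  a_lt_m : ∀ j, a j < m j
  m_le_b : ∀ j, m j ≤ b j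
  a_le_e : a i ≤ e
  e_lt_e' : e < e'
  e'_le_b : e' ≤ b i
  e'_le : ∀ p ∈ t, p ∉ E → e' ≤ p.1 i
  le_e : ∀ p ∈ E, p.1 i ≤ e
  widthLE : WidthLE (points t) k

theorem ChainStack.initialChain_reflect {d k k' : ℕ} {a b : Fin d → ℚ} {t : ColouredPoints d}
    {D : Fin d → ColouredPoints d} {c c' m : Fin d → ℚ}
    (h : ChainStack (-b) (-a) t D c c' m k k') (i : Fin d) :
    InitialChain a b (reflect t) (reflect (D i)) i (-m) (-c' i) (-c i) k where
  sub := Finset.image_subset_image (h.sub i)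
  chain p hp q hq := by
    rw [mem_reflect] at hp hq
    exact (h.chain i _ hp _ hq).symm.imp neg_le_neg_iff.1 neg_le_neg_iff.1
  lt_of_mem p hp j := neg_lt_neg_iff.1 (h.lt_of_mem _ (mem_reflect.1 hp) j)
  le_of_mem p hp j := neg_le.1 (h.le_of_mem _ (mem_reflect.1 hp) j)
  a_lt_m j := lt_neg.1 (h.m_lt_b j)
  m_le_b j := neg_le.1 ((h.a_le_c j).trans (h.c_le_m j))
  a_le_e := le_neg.1 (h.c'_le_b i)
  e_lt_e' := neg_lt_neg (h.c_lt_c' i)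
  e'_le_b := neg_le.1 (h.a_le_c i)
  e'_le p hp hpE := neg_le.1 (h.le_c i _ (mem_reflect.1 hp) fun h1 => hpE (mem_reflect.2 h1))
  le_e p hp := le_neg.1 (h.c'_le i _ (mem_reflect.1 hp))
  widthLE := by
    rw [points_reflect]
    exact h.widthLE.preimage_neg

theorem wins_of_initialChain {d w k K : ℕ} (hd : 2 ≤ d) {s : ColouredPoints d} {a b : Fin d → ℚ}
    (hs : Slot w s a b k) (i : Fin d)
    (H : ∀ t E m e e', InitialChain a b t E i m e e' k → k ≤ (colours E).card →
      Wins w K (s ∪ t)) : Wins w K s := by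
  rw [← reflect_reflect s]
  refine Wins.reflect (wins_of_chain hd k i _ _ _ hs.reflect fun t D c c' m h _ hk => ?_)
  rw [← reflect_reflect t, ← reflect_union]
  exact (H _ _ _ _ _ (h.initialChain_reflect i) (by simpa using hk)).reflect

/-! ### Combining a final and an initial chain -/

/-- Averaging: the sets `X ∩ Y i` are disjoint subsets of `X`, so the cardinalities of `X ∪ Y i` add
up to at least `(I.card - 1) * X.card + I.card * q`. With `q ≤ X.card` this is the source of the
factor `2 - 1 / (d - 1)`. -/
theorem Finset.exists_le_mul_card_union {ι : Type*} {α : Type*} [DecidableEq α] {I : Finset ι}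
    (hI : I.Nonempty) {X : Finset α} {Y : ι → Finset α} {q : ℕ}
    (hY : ∀ i ∈ I, ∀ j ∈ I, i ≠ j → Disjoint (Y i) (Y j)) (hX : q ≤ X.card)
    (hq : ∀ i ∈ I, q ≤ (Y i).card) :
    ∃ i ∈ I, (2 * I.card - 1) * q ≤ I.card * (X ∪ Y i).card := by
  refine Finset.exists_le_of_sum_le hI ?_
  rw [Finset.sum_const, smul_eq_mul, ← Finset.mul_sum]
  refine Nat.mul_le_mul_left _ ?_
  have h1 : ∑ i ∈ I, (X ∩ Y i).card ≤ X.card := by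
    rw [← Finset.card_biUnion]
    · exact Finset.card_le_card (Finset.biUnion_subset.2 fun i _ => Finset.inter_subset_left)
    · exact fun i hi j hj hij =>
        (hY i hi j hj hij).mono Finset.inter_subset_right Finset.inter_subset_right
  have h2 : I.card * X.card + I.card * q ≤
      ∑ i ∈ I, (X ∪ Y i).card + ∑ i ∈ I, (X ∩ Y i).card := by
    rw [← Finset.sum_add_distrib]
    simp only [Finset.card_union_add_card_inter]
    rw [Finset.sum_add_distrib, Finset.sum_const, smul_eq_mul]
    exact Nat.add_le_add_left (by simpa using Finset.card_nsmul_le_sum I _ q hq) _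
  obtain ⟨n, hn⟩ := Nat.exists_eq_succ_of_ne_zero hI.card_pos.ne'
  rw [hn] at h2 ⊢
  have h3 : n * q ≤ n * X.card := Nat.mul_le_mul_left _ hX
  have h4 : (2 * n.succ - 1) * q = n * q + n.succ * q := by
    rw [← Nat.add_mul]
    congr 1
    omega
  rw [h4]
  have h5 : n.succ * X.card = n * X.card + X.card := Nat.succ_mul _ _
  omega

section Level

variable {d w K k k' : ℕ}

/-- All of `t` lies below the box between `m` and `b`, so the full width `k` can be used a second
time there. -/
theorem ChainStack.slot_above {s t : ColouredPoints d} {D : Fin d → ColouredPoints d}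
    {a b c c' m : Fin d → ℚ} (h : ChainStack a b t D c c' m k k') (hs : Slot w s a b k) :
    Slot w (s ∪ t) m b k where
  lt := h.m_lt_b
  outside p hp j := by
    rw [points_union] at hp
    rcases hp with hp | ⟨x, hp⟩
    · exact (hs.outside p hp j).imp_left
        fun h1 => h1.trans ((h.a_le_c j).trans (h.c_le_m j))
    · exact Or.inl (h.le_of_mem _ hp j)
  full := by
    obtain ⟨A, hA, h1⟩ := hs.full
    exact ⟨A, hA.trans (points_mono Finset.subset_union_left), h1⟩
  width u hu hk := by
    rw [points_union, Set.union_assoc]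
    refine hs.width _ (Set.union_subset (fun p hp => h.mem_openBox hp) fun p hp j => ?_)
      (h.widthLE.union_of_comparable hk ?_)
    · exact ⟨((h.a_le_c j).trans (h.c_le_m j)).trans_lt (hu hp j).1, (hu hp j).2⟩
    · rintro p ⟨x, hp⟩ q hq
      exact Or.inl fun j => (h.le_of_mem _ hp j).trans (hu hq j).1.le

/-- A final chain of the lower part `t` and an initial chain of the upper part `t₂` form a chain
that is incomparable with all points of a box in which all other points are above the rest of `t`
and below the rest of `t₂`. -/
theorem ChainStack.slot_between {s t t₂ E : ColouredPoints d} {D : Fin d → ColouredPoints d}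
    {a b c c' m m₂ : Fin d → ℚ} {e e' : ℚ} {i r : Fin d}
    (h : ChainStack a b t D c c' m (k + 1) k') (hs : Slot w s a b (k + 1))
    (h₂ : InitialChain m b t₂ E r m₂ e e' (k + 1)) (hir : i ≠ r) :
    ∃ a' b', Slot w (s ∪ (t ∪ t₂)) a' b' k ∧ openBox a' b' ⊆ openBox a b ∧
      ∀ p ∈ E ∪ D i, ∀ q ∈ openBox a' b', ¬(p.1 ≤ q) ∧ ¬(q ≤ p.1) := by
  -- In coordinate `i` the box ends before `D i` and before all of `t₂`; in coordinate `r` it starts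
  -- after `E` and after all of `t`; elsewhere it lies between the two parts. Coordinates `i` and
  -- `r` make it incomparable with `E ∪ D i`.
  set a' : Fin d → ℚ := fun j => if j = i then c i else if j = r then e else m j with ha'
  set b' : Fin d → ℚ := fun j => if j = i then min (c' i) (m₂ i) else if j = r then e' else m₂ j
    with hb'
  have ha'i : a' i = c i := if_pos rfl
  have ha'r : a' r = e := by simp [ha', hir.symm]
  have ha'j (j) (hji : j ≠ i) (hjr : j ≠ r) : a' j = m j := by simp [ha', hji, hjr]
  have hb'i : b' i = min (c' i) (m₂ i) := if_pos rfl
  have hb'r : b' r = e' := by simp [hb', hir.symm]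
  have hb'j (j) (hji : j ≠ i) (hjr : j ≠ r) : b' j = m₂ j := by simp [hb', hji, hjr]
  have cases_index {P : Fin d → Prop} (h1 : P i) (h2 : P r)
      (h3 : ∀ j, j ≠ i → j ≠ r → P j) (j) : P j := by
    rcases eq_or_ne j i with rfl | hji
    · exact h1
    rcases eq_or_ne j r with rfl | hjr
    · exact h2
    exact h3 j hji hjr
  have ham (j) : a j ≤ m j := (h.a_le_c j).trans (h.c_le_m j)
  have haa' : ∀ j, a j ≤ a' j := cases_index (by rw [ha'i]; exact h.a_le_c i)
    (by rw [ha'r]; exact (ham r).trans h₂.a_le_e) (fun j h1 h2 => by rw [ha'j j h1 h2]; exact ham j)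
  have hb'b : ∀ j, b' j ≤ b j := cases_index (by rw [hb'i]; exact min_le_of_left_le (h.c'_le_b i))
    (by rw [hb'r]; exact h₂.e'_le_b) (fun j h1 h2 => by rw [hb'j j h1 h2]; exact h₂.m_le_b j)
  have ht (p) (hp : p ∈ t) (hpD : p ∉ D i) : ∀ j, p.1 j ≤ a' j :=
    cases_index (by rw [ha'i]; exact h.le_c i p hp hpD)
      (by rw [ha'r]; exact (h.le_of_mem p hp r).trans h₂.a_le_e)
      (fun j h1 h2 => by rw [ha'j j h1 h2]; exact h.le_of_mem p hp j)
  have ht₂ (p) (hp : p ∈ t₂) (hpE : p ∉ E) : ∀ j, b' j ≤ p.1 j :=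
    cases_index (by rw [hb'i]; exact min_le_of_right_le (h₂.le_of_mem p hp i))
      (by rw [hb'r]; exact h₂.e'_le p hp hpE)
      (fun j h1 h2 => by rw [hb'j j h1 h2]; exact h₂.le_of_mem p hp j)
  have hDr (p) (hp : p ∈ D i) : p.1 r ≤ a' r := by
    rw [ha'r]
    exact (h.le_of_mem p (h.sub i hp) r).trans h₂.a_le_e
  have hDi (p) (hp : p ∈ D i) : b' i ≤ p.1 i := by
    rw [hb'i]
    exact min_le_of_left_le (h.c'_le i p hp)
  have hEr (p) (hp : p ∈ E) : p.1 r ≤ a' r := by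
    rw [ha'r]
    exact h₂.le_e p hp
  have hEi (p) (hp : p ∈ E) : b' i ≤ p.1 i := by
    rw [hb'i]
    exact min_le_of_right_le (h₂.le_of_mem p (h₂.sub hp) i)
  have hbox : openBox a' b' ⊆ openBox a b := fun p hp j =>
    ⟨(haa' j).trans_lt (hp j).1, (hp j).2.trans_le (hb'b j)⟩
  have htt₂ (p) (hp : p ∈ t) (q) (hq : q ∈ t₂) : p.1 ≤ q.1 := fun j =>
    (h.le_of_mem p hp j).trans ((h₂.a_lt_m j).le.trans (h₂.le_of_mem q hq j))
  refine ⟨a', b', ⟨?_, ?_, ?_, ?_⟩, hbox, ?_⟩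
  · refine cases_index ?_ ?_ fun j h1 h2 => ?_
    · rw [ha'i, hb'i]
      exact lt_min (h.c_lt_c' i) ((h.c_le_m i).trans_lt (h₂.a_lt_m i))
    · rw [ha'r, hb'r]
      exact h₂.e_lt_e'
    · rw [ha'j j h1 h2, hb'j j h1 h2]
      exact h₂.a_lt_m j
  · intro p hp j
    rw [points_union, points_union] at hp
    rcases hp with hp | ⟨x, hp⟩ | ⟨x, hp⟩
    · exact (hs.outside p hp j).imp (fun h1 => h1.trans (haa' j)) (fun h1 => (hb'b j).trans h1)
    · by_cases hD : (p, x) ∈ D i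
      · refine cases_index (P := fun j => p j ≤ a' j ∨ b' j ≤ p j) (Or.inr (hDi _ hD))
          (Or.inl (hDr _ hD)) (fun j h1 h2 => Or.inl ?_) j
        rw [ha'j j h1 h2]
        exact h.le_of_mem _ hp j
      · exact Or.inl (ht _ hp hD j)
    · by_cases hE : (p, x) ∈ E
      · refine cases_index (P := fun j => p j ≤ a' j ∨ b' j ≤ p j) (Or.inr (hEi _ hE))
          (Or.inl (hEr _ hE)) (fun j h1 h2 => Or.inr ?_) j
        rw [hb'j j h1 h2]
        exact h₂.le_of_mem _ hp j
      · exact Or.inr (ht₂ _ hp hE j)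
  · obtain ⟨A, hA, h1⟩ := hs.full
    exact ⟨A, hA.trans (points_mono Finset.subset_union_left), h1⟩
  · intro u hu hk
    rw [points_union, points_union, Set.union_assoc]
    refine hs.width _ ?_ (WidthLE.union_of_chain (C := points (E ∪ D i)) ?_ hk ?_ ?_)
    · refine Set.union_subset (Set.union_subset (fun p hp => h.mem_openBox hp) ?_)
        (hu.trans hbox)
      rintro p ⟨x, hp⟩ j
      exact ⟨((ham j).trans_lt (h₂.a_lt_m j)).trans_le (h₂.le_of_mem _ hp j),
        h₂.lt_of_mem _ hp j⟩
    · refine h.widthLE.union_of_comparable h₂.widthLE ?_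
      rintro p ⟨x, hp⟩ q ⟨y, hq⟩
      exact Or.inl (htt₂ _ hp _ hq)
    · rintro p ⟨x, hp⟩ q ⟨y, hq⟩
      rcases Finset.mem_union.1 hp with hp | hp <;> rcases Finset.mem_union.1 hq with hq | hq
      · exact h₂.chain _ hp _ hq
      · exact Or.inr (htt₂ _ (h.sub i hq) _ (h₂.sub hp))
      · exact Or.inl (htt₂ _ (h.sub i hp) _ (h₂.sub hq))
      · exact h.chain i _ hp _ hq
    · rintro p (⟨x, hp⟩ | ⟨x, hp⟩) hpC q hq
      · exact Or.inl fun j => (ht _ hp (fun hD => hpC ⟨x, Finset.mem_union_right _ hD⟩) j).trans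
          (hu hq j).1.le
      · exact Or.inr fun j => (hu hq j).2.le.trans
          (ht₂ _ hp (fun hE => hpC ⟨x, Finset.mem_union_left _ hE⟩) j)
  · intro p hp q hq
    have hr : p.1 r ≤ a' r := (Finset.mem_union.1 hp).elim (hEr p) (hDr p)
    have hi : b' i ≤ p.1 i := (Finset.mem_union.1 hp).elim (hEi p) (hDi p)
    exact ⟨fun hle => absurd (hle i) (not_le.2 ((hq i).2.trans_le hi)),
      fun hle => absurd (hle r) (not_le.2 (hr.trans_lt (hq r).1))⟩

/-- In a slot of width `k + 1`, Anna can force a chain with many colours that is incomparable with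
all points of a slot of width `k`. -/
theorem wins_of_slot_succ (hd : 2 ≤ d) {s : ColouredPoints d} {a b : Fin d → ℚ}
    (hs : Slot w s a b (k + 1))
    (H : ∀ t C a' b', Slot w (s ∪ t) a' b' k → (∀ p ∈ t, p.1 ∈ openBox a b) → C ⊆ t →
      openBox a' b' ⊆ openBox a b →
      (∀ p ∈ C, ∀ q ∈ openBox a' b', ¬(p.1 ≤ q) ∧ ¬(q ≤ p.1)) →
      (2 * (d - 1) - 1) * (k + 1 - (d - 1)) ≤ (d - 1) * (colours C).card →
      Wins w K (s ∪ t)) : Wins w K s := by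
  have : Nontrivial (Fin d) := Fin.nontrivial_iff_two_le.2 hd
  -- One coordinate is reserved for `E`: the final chain must use a different one, which leaves `d -
  -- 1` candidates.
  let r : Fin d := ⟨0, by omega⟩
  have hcard : (Finset.univ.erase r).card = d - 1 := by simp
  refine wins_of_chains hd hs (Finset.univ.erase r) fun t D c c' m h _ hk => ?_
  rw [hcard] at hk
  refine wins_of_initialChain hd (h.slot_above hs) r fun t₂ E m₂ e e' h₂ hkE => ?_
  rw [Finset.union_assoc]
  refine .of_proper fun hproper => ?_
  have hsub (j) : D j ⊆ s ∪ (t ∪ t₂) :=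
    ((h.sub j).trans Finset.subset_union_left).trans Finset.subset_union_right
  obtain ⟨i, hi, hcol⟩ := Finset.exists_le_mul_card_union
    (Finset.card_pos.1 (by rw [hcard]; omega) : (Finset.univ.erase r).Nonempty)
    (X := colours E) (Y := fun i => colours (D i)) (q := k + 1 - (d - 1))
    (fun i _ j _ hij => hproper.disjoint_colours (hsub i) (hsub j) (h.incomparable hij))
    ((Nat.sub_le _ _).trans hkE) hk
  obtain ⟨a', b', hslot, hbox, hinc⟩ := h.slot_between hs h₂ (Finset.ne_of_mem_erase hi)
  refine H _ (E ∪ D i) a' b' hslot ?_ ?_ hbox hinc ?_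
  · intro p hp
    rcases Finset.mem_union.1 hp with hp | hp
    · exact h.mem_openBox (mem_points hp)
    · exact fun j => ⟨(((h.a_le_c j).trans (h.c_le_m j)).trans_lt (h₂.a_lt_m j)).trans_le
        (h₂.le_of_mem p hp j), h₂.lt_of_mem p hp j⟩
  · exact Finset.union_subset (h₂.sub.trans Finset.subset_union_right)
      ((h.sub i).trans Finset.subset_union_left)
  · rwa [hcard, ← colours_union] at hcol

/-- In a slot of width `k` all of whose points are incomparable with the points of `B`, Anna can
force many colours that do not occur in `B`. -/
theorem wins_of_slot (hd : 2 ≤ d) (k : ℕ) : ∀ (s B : ColouredPoints d) (a b : Fin d → ℚ),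
    Slot w s a b k → B ⊆ s → (∀ p ∈ B, ∀ q ∈ openBox a b, ¬(p.1 ≤ q) ∧ ¬(q ≤ p.1)) →
    (d - 1) * K ≤ (d - 1) * (colours B).card +
      ∑ j ∈ Finset.range k, (2 * (d - 1) - 1) * (j + 1 - (d - 1)) → Wins w K s := by
  induction k with
  | zero =>
    intro s B a b hs hB _ hK
    refine hs.wins (le_trans ?_ (Finset.card_le_card (colours_mono hB)))
    exact Nat.le_of_mul_le_mul_left (by simpa using hK) (by omega)
  | succ k ih =>
    intro s B a b hs hB hinc hK
    refine wins_of_slot_succ hd hs fun t C a' b' hs' ht hC hbox hincC hcard => ?_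
    refine .of_proper fun hproper => ?_
    refine ih _ (B ∪ C) a' b' hs' (Finset.union_subset_union hB hC) ?_ ?_
    · intro p hp q hq
      rcases Finset.mem_union.1 hp with hp | hp
      · exact hinc p hp q (hbox hq)
      · exact hincC p hp q hq
    -- `C` was played inside the box, all of whose points are incomparable with `B`, so its colours
    -- are new.
    · have hdisj := hproper.disjoint_colours (hB.trans Finset.subset_union_left)
        (hC.trans Finset.subset_union_right) fun p hp q hq => hinc p hp q.1 (ht q (hC hq))
      rw [colours_union, Finset.card_union_of_disjoint hdisj, Nat.mul_add]
      rw [Finset.sum_range_succ] at hK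
      omega

end Level

/-! ### The start of the game -/

/-- The points `(i, -i, …, -i)` form an antichain if `d ≥ 2`. -/
def antidiagonal (d : ℕ) (i : ℕ) : Fin d → ℚ := fun j => if (j : ℕ) = 0 then i else -i

theorem antidiagonal_ne {d i i' : ℕ} (h : i ≠ i') (j : Fin d) :
    antidiagonal d i j ≠ antidiagonal d i' j := by
  unfold antidiagonal
  split_ifs <;> simpa using h

theorem antidiagonal_le {d i i' : ℕ} (hd : 2 ≤ d) (h : antidiagonal d i ≤ antidiagonal d i') :
    i = i' := by
  have h0 := h ⟨0, by omega⟩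
  have h1 := h ⟨1, by omega⟩
  simp only [antidiagonal, if_true, one_ne_zero, if_false, neg_le_neg_iff, Nat.cast_le] at h0 h1
  exact le_antisymm h0 h1

/-- The antidiagonal antichain guarantees width `w` from the outset. -/
theorem wins_empty {d w K : ℕ} (hd : 2 ≤ d)
    (hK : (d - 1) * K ≤ ∑ j ∈ Finset.range w, (2 * (d - 1) - 1) * (j + 1 - (d - 1))) :
    Wins w K (∅ : ColouredPoints d) := by
  have hinj : Function.Injective (antidiagonal d) := fun i i' h => antidiagonal_le hd h.le
  have key (l : ℕ) : ∀ (n : ℕ) (s : ColouredPoints d), n + l = w →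
      points s = antidiagonal d '' Set.Iio n → Wins w K s := by
    induction l with
    | zero =>
      intro n s hn hs
      obtain rfl : n = w := hn
      have hA : ((Finset.range n).image (antidiagonal d) : Set (Fin d → ℚ)) = points s := by
        rw [hs]
        simp [Finset.coe_image]
      have hcard : ((Finset.range n).image (antidiagonal d)).card = n := by
        rw [Finset.card_image_of_injective _ hinj, Finset.card_range]
      have hlt : ∀ p ∈ points s, ∀ j, p j ≤ (n : ℚ) := by
        rw [hs]
        rintro _ ⟨i, hi, rfl⟩ j
        have hi' : (i : ℚ) ≤ n := by exact_mod_cast (Set.mem_Iio.1 hi).le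
        have : (0 : ℚ) ≤ i := i.cast_nonneg
        unfold antidiagonal
        split_ifs
        · exact hi'
        · linarith
      -- All coordinates of the antichain are at most `n`, so the box from `n` to `n + 1` lies above
      -- it and has the full width.
      refine wins_of_slot hd n s ∅ (fun _ => n) (fun _ => n + 1)
        ⟨fun j => by simp, fun p hp j => Or.inl (hlt p hp j), ⟨_, hA.subset, ?_, hcard⟩, ?_⟩
        (Finset.empty_subset _) (by simp) (by simpa using hK)
      · rw [hA, hs]
        rintro _ ⟨i, _, rfl⟩ _ ⟨i', _, rfl⟩ hne hle
        exact hne (by rw [antidiagonal_le hd hle])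
      · intro u hu hk
        refine WidthLE.union_of_comparable (fun B hB _ => ?_) hk fun p hp q hq =>
          Or.inl fun j => (hlt p hp j).trans (hu hq j).1.le
        rw [← hcard]
        refine Finset.card_le_card ?_
        rw [← Finset.coe_subset, hA]
        exact hB
    | succ l ih =>
      intro n s hn hs
      have hins : insert (antidiagonal d n) (points s) = antidiagonal d '' Set.Iio (n + 1) := by
        rw [hs, ← Set.image_insert_eq]
        congr 1
        ext i
        simp only [Set.mem_insert_iff, Set.mem_Iio]
        omega
      refine .move s (antidiagonal d n) ?_ ?_ fun x => ih (n + 1) _ (by omega) ?_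
      · rw [hs]
        rintro _ ⟨i, hi, rfl⟩ j
        exact antidiagonal_ne (ne_of_lt hi) j
      · rw [hins]
        intro B hB _
        have : B ⊆ (Finset.range (n + 1)).image (antidiagonal d) := by
          rw [← Finset.coe_subset, Finset.coe_image, Finset.coe_range]
          exact hB
        refine (Finset.card_le_card this).trans (Finset.card_image_le.trans ?_)
        rw [Finset.card_range]
        omega
      · rw [points_insert, hins]
  exact key w 0 ∅ (by omega) (by ext; simp [points])

/-! ### From coloured points to the presenter's strategies -/

namespace RealizedPoset

variable {d n : ℕ}

/-- The poset of points of `ℚ ^ d` in general position, ordered coordinatewise. -/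
def ofPoints (f : Fin n → Fin d → ℚ) (hf : ∀ j, Function.Injective fun i => f i j) :
    RealizedPoset d n where
  rel j x y := f x j ≤ f y j
  isLinearOrder j :=
    { refl := fun _ => le_rfl
      trans := fun _ _ _ => le_trans
      antisymm := fun _ _ h h' => hf j (le_antisymm h h')
      total := fun _ _ => le_total _ _ }

theorem injective_snoc {f : Fin n → Fin d → ℚ} (hf : ∀ j, Function.Injective fun i => f i j)
    {v : Fin d → ℚ} (hv : ∀ i j, f i j ≠ v j) (j : Fin d) :
    Function.Injective fun i => (Fin.snoc f v : Fin (n + 1) → Fin d → ℚ) i j := by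
  intro x y
  induction x using Fin.lastCases <;> induction y using Fin.lastCases
  · simp
  · intro h
    simp only [Fin.snoc_last, Fin.snoc_castSucc] at h
    exact absurd h.symm (hv _ j)
  · intro h
    simp only [Fin.snoc_last, Fin.snoc_castSucc] at h
    exact absurd h (hv _ j)
  · intro h
    simp only [Fin.snoc_castSucc] at h
    rw [hf j h]

theorem restrict_snoc {f : Fin n → Fin d → ℚ} (hf : ∀ j, Function.Injective fun i => f i j)
    {v : Fin d → ℚ} (hv : ∀ i j, f i j ≠ v j) :
    (ofPoints (Fin.snoc f v : Fin (n + 1) → Fin d → ℚ) (injective_snoc hf hv)).restrict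
      (Nat.le_succ n) = ofPoints f hf := by
  ext j x y
  change (Fin.snoc f v : Fin (n + 1) → Fin d → ℚ) x.castSucc j ≤
    (Fin.snoc f v : Fin (n + 1) → Fin d → ℚ) y.castSucc j ↔ f x j ≤ f y j
  rw [Fin.snoc_castSucc, Fin.snoc_castSucc]

theorem width_ofPoints_le {f : Fin n → Fin d → ℚ} (hf : ∀ j, Function.Injective fun i => f i j)
    (hinj : Function.Injective f) {w : ℕ} (hw : WidthLE (Set.range f) w) :
    (ofPoints f hf).width ≤ w := by
  classical
  refine Finset.sup_le fun A hA => ?_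
  rw [← Finset.card_image_of_injective A hinj]
  refine hw _ (by simp) ?_
  rw [Finset.coe_image]
  rintro _ ⟨x, hx, rfl⟩ _ ⟨y, hy, rfl⟩ hne hle
  exact (Finset.mem_filter.1 hA).2 hx hy (fun h => hne (by rw [h])) hle

theorem le_width_ofPoints {f : Fin n → Fin d → ℚ} (hf : ∀ j, Function.Injective fun i => f i j)
    {A : Finset (Fin d → ℚ)} (hA : (A : Set (Fin d → ℚ)) ⊆ Set.range f)
    (hanti : IsAntichain (· ≤ ·) (A : Set (Fin d → ℚ))) :
    A.card ≤ (ofPoints f hf).width := by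
  classical
  obtain ⟨B, -, hinj, rfl⟩ := Finset.exists_subset_injOn_image_eq_of_surjOn (f := f)
    (s := Set.univ) A (by simpa [Set.SurjOn] using hA)
  rw [Finset.card_image_of_injOn hinj]
  refine Finset.le_sup (f := Finset.card) (Finset.mem_filter.2 ⟨Finset.mem_univ _, ?_⟩)
  intro x hx y hy hne hle
  exact hanti (by simpa using ⟨x, hx, rfl⟩) (by simpa using ⟨y, hy, rfl⟩)
    (fun h => hne (hinj hx hy h)) hle

end RealizedPoset

theorem OnlineAlgorithm.colouring_castSucc {d n : ℕ} (A : OnlineAlgorithm d)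
    (R : RealizedPoset d (n + 1)) (i : Fin n) :
    A.colouring R i.castSucc = A.colouring (R.restrict (Nat.le_succ n)) i := rfl

namespace ColouredPoints

variable {d w K : ℕ}

/-- The coloured points of a position in the game. -/
def ofFun {n : ℕ} (f : Fin n → Fin d → ℚ) (c : Fin n → ℕ) : ColouredPoints d :=
  Finset.univ.image fun i => (f i, c i)

theorem points_ofFun {n : ℕ} (f : Fin n → Fin d → ℚ) (c : Fin n → ℕ) :
    points (ofFun f c) = Set.range f := by
  ext p; simp [points, ofFun]

theorem colours_ofFun {n : ℕ} (f : Fin n → Fin d → ℚ) (c : Fin n → ℕ) :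
    colours (ofFun f c) = Finset.univ.image c := by
  simp only [colours, ofFun, Finset.image_image]
  rfl

theorem ofFun_snoc {n : ℕ} (f : Fin n → Fin d → ℚ) (c : Fin n → ℕ) (v : Fin d → ℚ) (x : ℕ) :
    ofFun (Fin.snoc f v : Fin (n + 1) → Fin d → ℚ) (Fin.snoc c x : Fin (n + 1) → ℕ) =
      insert (v, x) (ofFun f c) := by
  ext p
  simp only [ofFun, Finset.mem_image, Finset.mem_insert, Finset.mem_univ, true_and,
    Fin.exists_fin_succ', Fin.snoc_castSucc, Fin.snoc_last]
  rw [or_comm, eq_comm (a := p)]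

open RealizedPoset

/-- If Anna wins from a set of coloured points, then she has a strategy that wins from every
position of the actual game that gives rise to this set. Here `T` is any strategy that agrees with
the constructed one from this position on. -/
theorem Wins.exists_strategy (hd : 0 < d) {s : ColouredPoints d} (h : Wins w K s) :
    ∀ (n : ℕ) (f : Fin n → Fin d → ℚ) (hf : ∀ j, Function.Injective fun i => f i j)
      (c : Fin n → ℕ), ofFun f c = s → WidthLE (Set.range f) w →
    ∃ S : AnnaStrategy d, ∀ A : OnlineAlgorithm d, A.PartitionsWidth w →
      A.colouring (ofPoints f hf) = c → ∀ T : AnnaStrategy d,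
      (∀ (m : ℕ) (hm : n ≤ m) (R : RealizedPoset d m) (c' : Fin m → ℕ),
        (∀ i, c' (Fin.castLE hm i) = c i) → T m R c' = S m R c') →
      T.Reaches A n (ofPoints f hf) →
      ∃ (m : ℕ) (R : RealizedPoset d m), T.Reaches A m R ∧ T m R (A.colouring R) = none ∧
        R.width = w ∧ K ≤ A.numChains R := by
  have finj {n : ℕ} {f : Fin n → Fin d → ℚ} (hf : ∀ j, Function.Injective fun i => f i j) :
      Function.Injective f := fun x y hxy => hf ⟨0, hd⟩ (congrFun hxy _)
  induction h with
  | done s hK hA _ =>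
    rintro n f hf c rfl hw
    refine ⟨fun _ _ _ => none, fun A _ hc T hT hreach => ⟨n, _, hreach, ?_, ?_, ?_⟩⟩
    · exact hT n le_rfl _ _ fun i => by rw [hc]; rfl
    · obtain ⟨A, hA, hanti, rfl⟩ := hA
      rw [points_ofFun] at hA
      exact le_antisymm (width_ofPoints_le hf (finj hf) hw) (le_width_ofPoints hf hA hanti)
    · rw [colours_ofFun] at hK
      rw [OnlineAlgorithm.numChains, hc]
      exact hK
  | improper s hs =>
    rintro n f hf c rfl hw
    refine ⟨fun _ _ _ => none, fun A hA hc T hT hreach => absurd ?_ hs⟩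
    have hpart := hA n _ (width_ofPoints_le hf (finj hf) hw)
    rw [hc] at hpart
    intro p hp q hq hpq
    obtain ⟨x, -, rfl⟩ := Finset.mem_image.1 hp
    obtain ⟨y, -, rfl⟩ := Finset.mem_image.1 hq
    exact hpart x y hpq
  | move s v hv hw _ ih =>
    rintro n f hf c rfl -
    rw [points_ofFun] at hw
    have hv' : ∀ i j, f i j ≠ v j := fun i j => hv (f i) (by simp [points_ofFun]) j
    have hrange : WidthLE (Set.range (Fin.snoc f v : Fin (n + 1) → Fin d → ℚ)) w := by
      refine hw.subset ?_
      rintro _ ⟨i, rfl⟩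
      induction i using Fin.lastCases <;> simp
    choose S hS using fun x => ih x (n + 1) (Fin.snoc f v) (injective_snoc hf hv') (Fin.snoc c x)
      (ofFun_snoc f c v x) hrange
    let R₁ : {R' : RealizedPoset d (n + 1) // R'.restrict (Nat.le_succ n) = ofPoints f hf} :=
      ⟨ofPoints (Fin.snoc f v) (injective_snoc hf hv'), restrict_snoc hf hv'⟩
    classical
    -- The colour of point `n` selects the continuation, and with exactly `n` points the move `v` is
    -- played. The default `none` serves positions that do not arise from here.
    let S₀ : AnnaStrategy d := fun m R c' =>
      if hm : n < m then S (c' ⟨n, hm⟩) m R c'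
      else if h : ∃ e : n = m, e ▸ ofPoints f hf = R then
        some ⟨h.1 ▸ R₁.1, by obtain ⟨rfl, rfl⟩ := h; exact R₁.2⟩
      else none
    refine ⟨S₀, fun A hA hc T hT hreach => ?_⟩
    have hT₀ : T n (ofPoints f hf) (A.colouring (ofPoints f hf)) = some R₁ := by
      rw [hT n le_rfl _ _ fun i => by rw [hc]; rfl]
      exact (dif_neg (lt_irrefl n)).trans (dif_pos ⟨rfl, rfl⟩)
    have hcol : A.colouring R₁.1 = Fin.snoc c (A.colouring R₁.1 (Fin.last n)) := by
      funext i
      induction i using Fin.lastCases with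
      | last => simp
      | cast i => rw [A.colouring_castSucc, R₁.2, hc, Fin.snoc_castSucc]
    refine hS _ A hA hcol T (fun m hm R c' hc' => ?_) (.step n _ R₁ hreach hT₀)
    have hlast : c' ⟨n, hm⟩ = A.colouring R₁.1 (Fin.last n) := by
      have := hc' (Fin.last n)
      rwa [Fin.snoc_last] at this
    rw [hT m (Nat.le_of_succ_le hm) R c' fun i => ?_, ← hlast]
    · exact dif_pos hm
    · have := hc' i.castSucc
      rwa [Fin.snoc_castSucc] at this

theorem Wins.exists_forces (hd : 0 < d) (h : Wins w K (∅ : ColouredPoints d)) :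
    ∃ S : AnnaStrategy d, S.Forces w K := by
  have hf (j : Fin d) : Function.Injective fun i : Fin 0 => (i.elim0 : Fin d → ℚ) j :=
    fun i => i.elim0
  obtain ⟨S, hS⟩ := h.exists_strategy hd 0 (fun i => i.elim0) hf (fun i => i.elim0) rfl
    (by simpa using WidthLE.empty)
  refine ⟨S, fun A hA => hS A hA (funext fun i => i.elim0) S (fun _ _ _ _ _ => rfl) ?_⟩
  have : ofPoints _ hf = RealizedPoset.start d := by
    ext j x
    exact x.elim0
  rw [this]
  exact .start

end ColouredPoints

/-! ### The lower bound -/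

theorem exists_forces {d : ℕ} (hd : 2 ≤ d) (w : ℕ) : ∃ S : AnnaStrategy d, S.Forces w
    ((∑ j ∈ Finset.range w, (2 * (d - 1) - 1) * (j + 1 - (d - 1))) / (d - 1)) :=
  (wins_empty hd (Nat.mul_div_le _ _)).exists_forces (by omega)

theorem lower_bound_le {d w : ℕ} (hd : 2 ≤ d) :
    (2 - 1 / ((d : ℝ) - 1) - 4 * d / w) * ((w + 1).choose 2 : ℝ) ≤
      (((∑ j ∈ Finset.range w, (2 * (d - 1) - 1) * (j + 1 - (d - 1))) / (d - 1) : ℕ) : ℝ) := by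
  obtain ⟨n, rfl⟩ : ∃ n, d = n + 2 := ⟨d - 2, by omega⟩
  -- For `w = 0` the quotient by `w` is `0` and the binomial coefficient vanishes.
  rcases Nat.eq_zero_or_pos w with rfl | hw
  · simp
  have hw' : (0 : ℝ) < w := by exact_mod_cast hw
  set N : ℝ := n + 1 with hN
  have hN1 : 1 ≤ N := by simp [hN]
  have hchoose : ((w + 1).choose 2 : ℝ) = (w + 1) * w / 2 := by
    rw [Nat.cast_choose_two]
    push_cast
    ring
  have hsum : ∀ v : ℕ, (2 * N - 1) * ((v + 1) * v / 2 - N * v) ≤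
      ((∑ j ∈ Finset.range v, (2 * (n + 2 - 1) - 1) * (j + 1 - (n + 2 - 1)) : ℕ) : ℝ) := by
    intro v
    induction v with
    | zero => simp
    | succ v ih =>
      rw [Finset.sum_range_succ, Nat.cast_add (Finset.sum _ _)]
      have h1 : ((v + 1 : ℕ) : ℝ) - N ≤ ((v + 1 - (n + 2 - 1) : ℕ) : ℝ) := by
        have : v + 1 ≤ (v + 1 - (n + 2 - 1)) + (n + 1) := by omega
        have : ((v + 1 : ℕ) : ℝ) ≤ ((v + 1 - (n + 2 - 1) : ℕ) : ℝ) + ((n + 1 : ℕ) : ℝ) := by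
          exact_mod_cast this
        push_cast [hN] at this ⊢
        linarith
      have h2 : ((2 * (n + 2 - 1) - 1 : ℕ) : ℝ) = 2 * N - 1 := by
        have : 2 * (n + 2 - 1) - 1 = 2 * n + 1 := by omega
        rw [this]
        push_cast [hN]
        ring
      rw [Nat.cast_mul, h2]
      have h3 := mul_le_mul_of_nonneg_left h1 (by linarith : 0 ≤ 2 * N - 1)
      have h4 : ((v + 1 : ℕ) : ℝ) = v + 1 := Nat.cast_succ v
      rw [h4] at h3 ⊢
      linarith
  have hdiv := Nat.lt_div_mul_add (a := ∑ j ∈ Finset.range w,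
    (2 * (n + 2 - 1) - 1) * (j + 1 - (n + 2 - 1))) (b := n + 2 - 1) (by omega)
  set Q := (∑ j ∈ Finset.range w, (2 * (n + 2 - 1) - 1) * (j + 1 - (n + 2 - 1))) / (n + 2 - 1)
  have hQ : (2 * N - 1) * ((w + 1) * w / 2 - N * w) ≤ Q * N + N := by
    refine (hsum w).trans ?_
    have := hdiv.le
    have h2 : n + 2 - 1 = n + 1 := by omega
    rw [h2] at this ⊢
    have := (Nat.cast_le (α := ℝ)).2 this
    push_cast at this ⊢
    linarith
  have hd' : ((n + 2 : ℕ) : ℝ) - 1 = N := by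
    push_cast [hN]
    ring
  have hd'' : ((n + 2 : ℕ) : ℝ) = N + 1 := by linarith
  rw [hchoose, hd', hd'']
  -- With `N = d - 1`, the error term contributes `2 * (N + 1) * (w + 1) * N`. This absorbs the loss
  -- `(2 * N - 1) * N * w` from the truncated chain lengths and the loss `N` from the integer
  -- division.
  have key : (2 - 1 / N - 4 * (N + 1) / w) * ((w + 1) * w / 2) =
      ((2 * N - 1) * ((w + 1) * w / 2) - 2 * (N + 1) * (w + 1) * N) / N := by
    field_simp
    ring
  rw [key, div_le_iff₀ (by linarith)]
  nlinarith [mul_pos hw' (by linarith : 0 < N)]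

theorem theorem1p2 (d : ℕ) (hd : 2 ≤ d) :
    ∃ e : ℕ → ℝ, e =o[atTop] (fun _ => (1 : ℝ)) ∧
      ∀ w : ℕ,
        (((2 - 1 / ((d : ℝ) - 1) - e w) * ((w + 1).choose 2 : ℝ) : ℝ) : EReal)
            ≤ (((olwR w d : ℕ∞) : ENNReal) : EReal) ∧
        ∀ A : OnlineAlgorithm d, A.PartitionsWidth w →
          ∃ (n : ℕ) (R : RealizedPoset d n), R.width = w ∧
            (2 - 1 / ((d : ℝ) - 1) - e w) * ((w + 1).choose 2 : ℝ) ≤ (A.numChains R : ℝ) := by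
  refine ⟨fun w => 4 * d / w, ?_, fun w => ?_⟩
  · rw [isLittleO_one_iff]
    exact tendsto_const_div_atTop_nhds_zero_nat _
  obtain ⟨S, hS⟩ := exists_forces hd w
  have hcast (k : ℕ) : ((k : ℝ) : EReal) = (((k : ℕ∞) : ENNReal) : EReal) := by
    rw [ENat.toENNReal_coe]
    rfl
  refine ⟨?_, fun A hA => ?_⟩
  · refine (EReal.coe_le_coe_iff.2 (lower_bound_le hd)).trans ?_
    refine le_trans (le_of_eq (hcast _)) (EReal.coe_ennreal_le_coe_ennreal_iff.2
      (ENat.toENNReal_le.2 (le_iSup₂ (f := fun (k : ℕ) (_ : k ∈ {k : ℕ | ∃ S : AnnaStrategy d,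
        S.Forces w k}) => (k : ℕ∞)) _ ⟨S, hS⟩)))
  · obtain ⟨n, R, -, -, hwidth, hcard⟩ := hS A hA
    exact ⟨n, R, hwidth, (lower_bound_le hd).trans (by exact_mod_cast hcard)⟩
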